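/- **Burau functor.** Let $B_\infty$ be the group with generators $\sigma_i$ ($i\ge 1$) and relations $\sigma_i\sigma_j=\sigma_j\sigma_i$ for $|i-j|\ge 2$ and $\sigma_i\sigma_{i+1}\sigma_i=\sigma_{i+1}\sigma_i\sigma_{i+1}$. For integers $\alpha,\beta\ge 0$ and $n>0$ put $B_\infty[\alpha]=\langle \sigma_j : j>\alpha\rangle$, $\tau_i^{(n)}=\sigma_{n+\beta+i}\sigma_{n+\beta+i-1}\cdots\sigma_{\beta+i+1}$ and $\theta_n[\beta]=\tau_0^{(n)}\tau_1^{(n)}\cdots\tau_{n-1}^{(n)}$. Let $\mathrm{GL}(\infty)=\varinjlim \mathrm{GL}(n,\mathbb Z[t,t^{-1}])$ be the group of invertible infinite matrices of the form $\mathrm{diag}(T,1_\infty)$. Let $v=(1,t,t^2,\dots)$ and $u=(1,1,1,\dots)$, let $G[n]$ be the subgroup of all matrices $\mathrm{diag}(1_n,X)$ with $X\in \mathrm{GL}(\infty)$, $v^{\mathrm T}X=v^{\mathrm T}$ and $Xu=u$, and let $$\Theta_j[k]=\begin{pmatrix}1_k&0&0&0\\0&V_j&t^j1_j&0\\0&1_j&0&0\\0&0&0&1_\infty\end{pmatrix},\qquad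 V_j=(1-t)\begin{pmatrix}1&t&\cdots&t^{j-1}\\ \vdots&\vdots&&\vdots\\1&t&\cdots&t^{j-1}\end{pmatrix}.$$ Let $\eta\colon B_\infty\to \mathrm{GL}(\infty)$ be the Burau representation, the homomorphism with $\eta(\sigma_i)=\mathrm{diag}\left(1_{i-1},\begin{pmatrix}1-t&t\\1&0\end{pmatrix},1_\infty\right)$. For a group $G$ with a family $K[\ast]=(K[s])_{s\ge 0}$ of subgroups, and a family of products $K[r]\backslash G/K[s]\times K[s]\backslash G/K[t]\to K[r]\backslash G/K[t]$ (for all integers $r,s,t\ge 0$) that is associative and has the classes of $1\in G$ in the $K[r]\backslash G/K[r]$ as two-sided units, let $\mathcal K(G,K[\ast])$ be the category whose objects are the nonnegative integers, with $\mathrm{Hom}(r,s)=K[s]\backslash G/K[r]$ and with composition given by the product. Then: 1. For all $p,q\in B_\infty$ and $\alpha,\beta,\gamma\ge 0$ the double coset $B_\infty[\alpha]\,p\,\theta_n[\beta]\,q\,B_\infty[\gamma]$ is the same for all sufficiently large $n$, and this eventual value depends only on the double cosets $\mathfrak p=B_\infty[\alpha]pB_\infty[\beta]$ and $\mathfrak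 q=B_\infty[\beta]qB_\infty[\gamma]$. The resulting product $\mathfrak p\circ\mathfrak q$ is associative and has the classes of $1$ as units, so it defines the category $\mathcal K(B_\infty,B_\infty[\ast])$. 2. For all $p,q\in \mathrm{GL}(\infty)$ and $n,k,m\ge 0$ the double coset $G[n]\,p\,\Theta_j[k]\,q\,G[m]$ is the same for all sufficiently large $j$, and this eventual value depends only on $\mathfrak p=G[n]pG[k]$ and $\mathfrak q=G[k]qG[m]$. The resulting product $\mathfrak p\star_t\mathfrak q$ is associative and has the classes of $1$ as units, so it defines the category $\mathcal K(\mathrm{GL}(\infty),G[\ast])$. 3. There is a functor $\mathcal K(B_\infty,B_\infty[\ast])\to\mathcal K(\mathrm{GL}(\infty),G[\ast])$ that is the identity on objects and sends $B_\infty[s]\,p\,B_\infty[r]\in\mathrm{Hom}(r,s)$ to $G[s]\,\eta(p)\,G[r]$, for all $r,s\ge 0$ and $p\in B_\infty$. -/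

import Mathlib

open CategoryTheory

noncomputable section

namespace BurauFunctor

/-! ### The infinite braid group

Strands and elementary braids are numbered from `0`: the generator with index `i : ℕ` is the
elementary braid usually written `σ_{i+1}`. -/

/-- The braid relations on the generators `σ i`, `i : ℕ`. -/
def braidRels : Set (FreeGroup ℕ) :=
  {r | ∃ i j : ℕ, i + 2 ≤ j ∧
      r = (FreeGroup.of i * FreeGroup.of j) * (FreeGroup.of j * FreeGroup.of i)⁻¹} ∪
  {r | ∃ i : ℕ,
      r = (FreeGroup.of i * FreeGroup.of (i + 1) * FreeGroup.of i) *
        (FreeGroup.of (i + 1) * FreeGroup.of i * FreeGroup.of (i + 1))⁻¹}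

/-- The infinite braid group `B_∞`. -/
abbrev BInf : Type := PresentedGroup braidRels

/-- The elementary braid `σ i` (crossing the strands `i` and `i + 1`, counted from `0`). -/
def σ (i : ℕ) : BInf := PresentedGroup.of i

/-- The subgroup `B_∞[α]`, generated by the elementary braids that do not touch the first `α`
strands. In the numbering from `1` these are the `σ_j` with `j > α`. -/
def BSub (α : ℕ) : Subgroup BInf := Subgroup.closure {b | ∃ i, α ≤ i ∧ b = σ i}

/-- The braid `τ_i^{(n)} = σ_{n+β+i} σ_{n+β+i-1} ⋯ σ_{β+i+1}` (numbering from `1`), that is the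
product of the `σ (β + i + m)` for `m = n - 1, n - 2, …, 0` in this order. -/
def τ (β n i : ℕ) : BInf := ((List.range n).reverse.map fun m => σ (β + i + m)).prod

/-- The braid `θ_n[β] = τ_0^{(n)} τ_1^{(n)} ⋯ τ_{n-1}^{(n)}`. -/
def θ (n β : ℕ) : BInf := ((List.range n).map fun i => τ β n i).prod

/-! ### The group `GL(∞)` over `ℤ[t, t⁻¹]` -/

/-- The ring `ℤ[t, t⁻¹]`. -/
abbrev R : Type := LaurentPolynomial ℤ

/-- The variable `t`. -/
def t : R := LaurentPolynomial.T 1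

/-- Automorphisms of the free module with basis `e_0, e_1, …`. -/
abbrev AutFree : Type := (ℕ →₀ R) ≃ₗ[R] (ℕ →₀ R)

/-- The infinite matrix of an automorphism: column `j` is the image of `e_j`. -/
def entry (g : AutFree) : Matrix ℕ ℕ R := fun i j => g (Finsupp.single j 1) i

/-- `g = diag(T, 1_∞)` for some square matrix `T` of size `N`. -/
def IsFinitary (N : ℕ) (g : AutFree) : Prop :=
  ∀ i j, N ≤ i ∨ N ≤ j → entry g i j = (1 : Matrix ℕ ℕ R) i j

lemma isFinitary_iff {N : ℕ} {g : AutFree} : IsFinitary N g ↔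
    (∀ j, N ≤ j → g (Finsupp.single j 1) = Finsupp.single j 1) ∧
      ∀ i, N ≤ i → ∀ x, g x i = x i := by
  constructor
  · intro h
    refine ⟨fun j hj => ?_, fun i hi x => ?_⟩
    · ext1 i
      have := h i j (Or.inr hj)
      rw [entry, Matrix.one_apply] at this
      rw [this, Finsupp.single_apply]
      simp [eq_comm]
    · have : (Finsupp.lapply i ∘ₗ g.toLinearMap : (ℕ →₀ R) →ₗ[R] R) = Finsupp.lapply i := by
        ext j
        have := h i j (Or.inl hi)
        rw [entry, Matrix.one_apply] at this
        simp [this, Finsupp.single_apply, eq_comm]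
      exact LinearMap.congr_fun this x
  · rintro ⟨h1, h2⟩ i j (hi | hj)
    · rw [entry, h2 i hi, Matrix.one_apply, Finsupp.single_apply]
      simp [eq_comm]
    · rw [entry, h1 j hj, Matrix.one_apply, Finsupp.single_apply]
      simp [eq_comm]

lemma IsFinitary.mono {N M : ℕ} {g : AutFree} (h : IsFinitary N g) (hNM : N ≤ M) :
    IsFinitary M g :=
  fun i j hij => h i j (hij.imp hNM.trans hNM.trans)

/-- The group `GL(∞)`: invertible infinite matrices that differ from the identity matrix only
inside some upper left `N × N` block. This is the union of the groups `GL(N, ℤ[t, t⁻¹])`. -/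
def GLInf : Subgroup AutFree where
  carrier := {g | ∃ N, IsFinitary N g}
  one_mem' := ⟨0, isFinitary_iff.2 ⟨fun _ _ => rfl, fun _ _ _ => rfl⟩⟩
  mul_mem' := by
    rintro g h ⟨N, hN⟩ ⟨M, hM⟩
    have hg := isFinitary_iff.1 (hN.mono (le_max_left N M))
    have hh := isFinitary_iff.1 (hM.mono (le_max_right N M))
    refine ⟨max N M, isFinitary_iff.2 ⟨fun j hj => ?_, fun i hi x => ?_⟩⟩
    · rw [LinearEquiv.mul_apply, hh.1 j hj, hg.1 j hj]
    · rw [LinearEquiv.mul_apply, hg.2 i hi, hh.2 i hi]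
  inv_mem' := by
    rintro g ⟨N, hN⟩
    have hg := isFinitary_iff.1 hN
    refine ⟨N, isFinitary_iff.2 ⟨fun j hj => ?_, fun i hi x => ?_⟩⟩
    · exact (LinearEquiv.symm_apply_eq g).2 (hg.1 j hj).symm
    · have := hg.2 i hi (g.symm x)
      rw [LinearEquiv.apply_symm_apply] at this
      exact this.symm

/-- The `(i, j)` entry of an element of `GL(∞)`. -/
def mat (X : GLInf) : Matrix ℕ ℕ R := entry (X : AutFree)

/-- The decomposition of the free module given by the first `n` basis vectors and the others. -/
def split (n : ℕ) : (ℕ →₀ R) ≃ₗ[R] (Fin n → R) × (ℕ →₀ R) :=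
  (Finsupp.domLCongr (finSumNatEquiv n).symm).trans <|
    (Finsupp.sumFinsuppLEquivProdFinsupp R).trans <|
      (Finsupp.linearEquivFunOnFinite R R (Fin n)).prodCongr (LinearEquiv.refl R _)

lemma split_fst (n : ℕ) (x : ℕ →₀ R) (i : Fin n) : (split n x).1 i = x i := by
  simp [split]

lemma split_snd (n : ℕ) (x : ℕ →₀ R) (i : ℕ) : (split n x).2 i = x (n + i) := by
  simp [split]

/-- The automorphism with matrix `diag(T, X)`, where `T` has size `n`. -/
def blockAut (n : ℕ) : GL (Fin n) R × AutFree →* AutFree where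
  toFun p := (split n).trans <|
    ((LinearMap.GeneralLinearGroup.generalLinearEquiv R _
      (Matrix.GeneralLinearGroup.toLin p.1)).prodCongr p.2).trans (split n).symm
  map_one' := by
    ext1 x
    simp
  map_mul' p q := by
    ext1 x
    simp

lemma split_blockAut (n : ℕ) (T : GL (Fin n) R) (X : AutFree) (x : ℕ →₀ R) :
    split n (blockAut n (T, X) x) = (T.1.mulVec (split n x).1, X (split n x).2) := by
  simp [blockAut]

lemma isFinitary_blockAut (n : ℕ) (T : GL (Fin n) R) {N : ℕ} {X : AutFree}
    (hX : IsFinitary N X) : IsFinitary (n + N) (blockAut n (T, X)) := by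
  have h := isFinitary_iff.1 hX
  refine isFinitary_iff.2 ⟨fun j hj => ?_, fun i hi x => ?_⟩
  · apply (split n).injective
    obtain ⟨k, rfl⟩ := Nat.exists_eq_add_of_le hj
    have h1 : (split n (Finsupp.single (n + N + k) 1)).1 = 0 := by
      ext i
      rw [split_fst, Finsupp.single_eq_of_ne (by have := i.2; omega)]
      rfl
    have h2 : (split n (Finsupp.single (n + N + k) 1)).2 = Finsupp.single (N + k) 1 := by
      ext1 i
      rw [split_snd, Finsupp.single_apply, Finsupp.single_apply]
      congr 1
      exact propext ⟨fun h => by omega, fun h => by omega⟩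
    rw [split_blockAut]
    ext1
    · rw [h1, Matrix.mulVec_zero]
    · rw [h2, h.1 _ (by omega)]
  · obtain ⟨k, rfl⟩ := Nat.exists_eq_add_of_le hi
    rw [add_assoc, ← split_snd, split_blockAut, h.2 _ (by omega), split_snd]

/-- The element `diag(T, X)` of `GL(∞)`, for `T ∈ GL(n)` and `X ∈ GL(∞)`. -/
def blockDiag (n : ℕ) : GL (Fin n) R × GLInf →* GLInf :=
  ((blockAut n).comp ((MonoidHom.id _).prodMap GLInf.subtype)).codRestrict GLInf
    fun p => p.2.2.elim fun N hN => ⟨n + N, isFinitary_blockAut n p.1 hN⟩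

/-- The element `diag(1_n, X)` of `GL(∞)`. -/
def shift (n : ℕ) : GLInf →* GLInf := (blockDiag n).comp (MonoidHom.inr _ _)

/-- The element `diag(T, 1_∞)` of `GL(∞)`. -/
def ofGL (n : ℕ) : GL (Fin n) R →* GLInf := (blockDiag n).comp (MonoidHom.inl _ _)

/-- The row vector `w X`. All sums are finite, since the columns of `X` have finite support. -/
def rowMul (w : ℕ → R) (X : GLInf) : ℕ → R := fun j => ∑ᶠ i, w i * mat X i j

/-- The column vector `X w`. All sums are finite, since the rows of `X` have finite support. -/
def mulCol (X : GLInf) (w : ℕ → R) : ℕ → R := fun i => ∑ᶠ j, mat X i j * w j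

/-- The vector `v = (1, t, t², …)`. -/
def v : ℕ → R := fun i => t ^ i

/-- The vector `u = (1, 1, 1, …)`. -/
def u : ℕ → R := fun _ => 1

lemma rowMul_eq_iff (w : ℕ → R) (X : GLInf) : rowMul w X = w ↔
    Finsupp.linearCombination R w ∘ₗ (X : AutFree).toLinearMap = Finsupp.linearCombination R w := by
  have key (j : ℕ) : rowMul w X j =
      Finsupp.linearCombination R w ((X : AutFree) (Finsupp.single j 1)) := by
    rw [Finsupp.linearCombination_apply, Finsupp.sum, rowMul]
    rw [finsum_eq_sum_of_support_subset]
    · exact Finset.sum_congr rfl fun i _ => mul_comm _ _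
    · intro i hi
      simp only [Function.mem_support] at hi
      simp only [Finset.mem_coe, Finsupp.mem_support_iff]
      exact fun h => hi (by rw [mat, entry, h, mul_zero])
  constructor
  · intro h
    ext j
    have := key j
    rw [h] at this
    simp [← this]
  · intro h
    ext1 j
    have := LinearMap.congr_fun h (Finsupp.single j 1)
    rw [LinearMap.comp_apply, LinearEquiv.coe_coe, ← key j] at this
    simpa using this

/-- The truncation `e_0 + ⋯ + e_{N-1}` of the vector `u`. -/
def uTrunc (N : ℕ) : ℕ →₀ R := ∑ j ∈ Finset.range N, Finsupp.single j 1

lemma mulCol_u_eq_iff {N : ℕ} {X : GLInf} (hX : IsFinitary N X) :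
    mulCol X u = u ↔ (X : AutFree) (uTrunc N) = uTrunc N := by
  have h := isFinitary_iff.1 hX
  have hu (i : ℕ) : uTrunc N i = if i < N then 1 else 0 := by
    simp [uTrunc, Finsupp.finsetSum_apply, Finsupp.single_apply]
  have key (i : ℕ) (hi : i < N) : mulCol X u i = (X : AutFree) (uTrunc N) i := by
    rw [mulCol, finsum_eq_sum_of_support_subset (s := Finset.range N)]
    · simp [uTrunc, Finsupp.finsetSum_apply, mat, entry, u]
    · intro j hj
      simp only [Function.mem_support] at hj
      simp only [Finset.coe_range, Set.mem_Iio]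
      by_contra hjN
      apply hj
      rw [mat, hX i j (Or.inr (by omega)), Matrix.one_apply_ne (by omega), zero_mul]
  have key' (i : ℕ) (hi : N ≤ i) : mulCol X u i = 1 := by
    rw [mulCol, finsum_eq_single _ i]
    · rw [mat, hX i i (Or.inl hi), Matrix.one_apply_eq, u, mul_one]
    · intro j hj
      rw [mat, hX i j (Or.inl hi), Matrix.one_apply_ne hj.symm, zero_mul]
  constructor
  · intro hXu
    ext1 i
    rcases lt_or_ge i N with hi | hi
    · rw [← key i hi, hXu, hu, if_pos hi, u]
    · rw [h.2 i hi]
  · intro hXu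
    ext1 i
    rcases lt_or_ge i N with hi | hi
    · rw [key i hi, hXu, hu, if_pos hi, u]
    · rw [key' i hi, u]

/-- The subgroup of `GL(∞)` of all `X` with `vᵀ X = vᵀ` and `X u = u`. -/
def fixSub : Subgroup GLInf where
  carrier := {X | rowMul v X = v ∧ mulCol X u = u}
  one_mem' := by
    refine ⟨(rowMul_eq_iff v 1).2 rfl, ?_⟩
    have h : IsFinitary 0 ((1 : GLInf) : AutFree) :=
      isFinitary_iff.2 ⟨fun _ _ => rfl, fun _ _ _ => rfl⟩
    exact (mulCol_u_eq_iff h).2 rfl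
  mul_mem' := by
    rintro X Y ⟨hX, hX'⟩ ⟨hY, hY'⟩
    refine ⟨?_, ?_⟩
    · rw [rowMul_eq_iff] at hX hY ⊢
      refine LinearMap.ext fun x => ?_
      have h1 := LinearMap.congr_fun hX ((Y : AutFree) x)
      have h2 := LinearMap.congr_fun hY x
      exact h1.trans h2
    · obtain ⟨N, hN⟩ := X.2
      obtain ⟨M, hM⟩ := Y.2
      obtain ⟨L, hL⟩ := (X * Y).2
      have a := (mulCol_u_eq_iff (hN.mono (show N ≤ N + M + L by omega))).1 hX'
      have b := (mulCol_u_eq_iff (hM.mono (show M ≤ N + M + L by omega))).1 hY'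
      refine (mulCol_u_eq_iff (hL.mono (show L ≤ N + M + L by omega))).2 ?_
      rw [Subgroup.coe_mul, LinearEquiv.mul_apply, b, a]
  inv_mem' := by
    rintro X ⟨hX, hX'⟩
    have h1 (x : ℕ →₀ R) : (X : AutFree) (((X⁻¹ : GLInf) : AutFree) x) = x := by
      rw [← LinearEquiv.mul_apply, ← Subgroup.coe_mul, mul_inv_cancel]
      rfl
    have h2 (x : ℕ →₀ R) : ((X⁻¹ : GLInf) : AutFree) ((X : AutFree) x) = x := by
      rw [← LinearEquiv.mul_apply, ← Subgroup.coe_mul, inv_mul_cancel]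
      rfl
    refine ⟨?_, ?_⟩
    · rw [rowMul_eq_iff] at hX ⊢
      refine LinearMap.ext fun x => ?_
      have h := LinearMap.congr_fun hX (((X⁻¹ : GLInf) : AutFree) x)
      rw [LinearMap.comp_apply, LinearEquiv.coe_coe, h1] at h
      rw [LinearMap.comp_apply, LinearEquiv.coe_coe, h]
    · obtain ⟨N, hN⟩ := X.2
      obtain ⟨M, hM⟩ := (X⁻¹).2
      have a := (mulCol_u_eq_iff (hN.mono (le_max_left N M))).1 hX'
      refine (mulCol_u_eq_iff (hM.mono (le_max_right N M))).2 ?_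
      have h := h2 (uTrunc (max N M))
      rwa [a] at h

/-- The subgroup `G[n]` of all matrices `diag(1_n, X)` with `X ∈ GL(∞)`, `vᵀ X = vᵀ`, `X u = u`. -/
def GSub (n : ℕ) : Subgroup GLInf := fixSub.map (shift n)

lemma t_pow_mul (j : ℕ) : t ^ j * LaurentPolynomial.T (-(j : ℤ)) = 1 := by
  rw [t, LaurentPolynomial.T_pow, ← LaurentPolynomial.T_add]
  simp

/-- The `j × j` matrix `V_j = (1 - t) (t^b)_{a,b}`, with `0 ≤ a, b < j`. -/
def Vmat (j : ℕ) : Matrix (Fin j) (Fin j) R := fun _ b => (1 - t) * t ^ (b : ℕ)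

/-- The invertible matrix with the blocks `V_j`, `t^j 1_j`, `1_j`, `0`. -/
def ThetaBlock (j : ℕ) : GL (Fin j ⊕ Fin j) R where
  val := Matrix.fromBlocks (Vmat j) (t ^ j • 1) 1 0
  inv := Matrix.fromBlocks 0 1 ((LaurentPolynomial.T (-(j : ℤ)) : R) • 1)
    (-(LaurentPolynomial.T (-(j : ℤ)) : R) • Vmat j)
  val_inv := by
    rw [Matrix.fromBlocks_multiply, ← Matrix.fromBlocks_one]
    congr 1 <;> simp [smul_smul, t_pow_mul]
  inv_val := by
    rw [Matrix.fromBlocks_multiply, ← Matrix.fromBlocks_one]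
    congr 1 <;> simp [smul_smul, t_pow_mul]

/-- The matrix `Θ_j[k] = diag(1_k, B, 1_∞)`, where `B` has the blocks `V_j`, `t^j 1_j`, `1_j`,
`0`. -/
def Theta (j k : ℕ) : GLInf :=
  shift k (ofGL (j + j)
    (Units.mapEquiv (Matrix.reindexRingEquiv R finSumFinEquiv).toMulEquiv (ThetaBlock j)))

/-! ### The Burau representation -/

/-- The invertible matrix with rows `(1 - t, t)` and `(1, 0)`. -/
def burauBlock : GL (Fin 2) R where
  val := !![1 - t, t; 1, 0]
  inv := !![0, 1; LaurentPolynomial.T (-1), 1 - LaurentPolynomial.T (-1)]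
  val_inv := by
    have h := t_pow_mul 1
    simp only [pow_one, Nat.cast_one] at h
    ext i j
    fin_cases i <;> fin_cases j <;> simp [Matrix.mul_apply, h, mul_sub]
  inv_val := by
    have h := t_pow_mul 1
    simp only [pow_one, Nat.cast_one] at h
    rw [mul_comm] at h
    ext i j
    fin_cases i <;> fin_cases j <;> simp [Matrix.mul_apply, h, mul_sub]

/-- The matrix `diag(1_i, B, 1_∞)` where `B` has rows `(1 - t, t)` and `(1, 0)`. -/
def burauGen (i : ℕ) : GLInf := shift i (ofGL 2 burauBlock)

lemma shift_apply (n : ℕ) (X : GLInf) (x : ℕ →₀ R) (k : ℕ) :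
    (shift n X : AutFree) x k = if k < n then x k else (X : AutFree) (split n x).2 (k - n) := by
  have h : split n ((shift n X : AutFree) x) = ((split n x).1, (X : AutFree) (split n x).2) := by
    have := split_blockAut n 1 X x
    rw [Units.val_one, Matrix.one_mulVec] at this
    exact this
  split_ifs with hk
  · have := congrFun (congrArg Prod.fst h) ⟨k, hk⟩
    rwa [split_fst, split_fst] at this
  · obtain ⟨m, rfl⟩ := Nat.exists_eq_add_of_le (not_lt.1 hk)
    rw [← split_snd, h, Nat.add_sub_cancel_left]

lemma ofGL_apply (n : ℕ) (T : GL (Fin n) R) (x : ℕ →₀ R) (k : ℕ) :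
    (ofGL n T : AutFree) x k =
      if h : k < n then T.1.mulVec (split n x).1 ⟨k, h⟩ else x k := by
  have h : split n ((ofGL n T : AutFree) x) = (T.1.mulVec (split n x).1, (split n x).2) :=
    split_blockAut n T 1 x
  split_ifs with hk
  · have := congrFun (congrArg Prod.fst h) ⟨k, hk⟩
    rwa [split_fst] at this
  · obtain ⟨m, rfl⟩ := Nat.exists_eq_add_of_le (not_lt.1 hk)
    rw [← split_snd, h, split_snd]

lemma burauGen_apply (i : ℕ) (x : ℕ →₀ R) (k : ℕ) :
    (burauGen i : AutFree) x k =
      if k = i then (1 - t) * x i + t * x (i + 1) else if k = i + 1 then x i else x k := by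
  rw [burauGen, shift_apply, ofGL_apply]
  rcases lt_trichotomy k i with hk | rfl | hk
  · rw [if_pos hk, if_neg (by omega), if_neg (by omega)]
  · simp [Matrix.mulVec, dotProduct, Fin.sum_univ_two, split_fst, split_snd, burauBlock]
  · obtain ⟨m, rfl⟩ := Nat.exists_eq_add_of_lt hk
    rcases m with _ | m
    · simp [Matrix.mulVec, dotProduct, Fin.sum_univ_two, split_fst, split_snd, burauBlock]
    · rw [if_neg (by omega), dif_neg (by omega), if_neg (by omega), if_neg (by omega), split_snd]
      congr 1
      omega

lemma burauGen_comm {i j : ℕ} (h : i + 2 ≤ j) :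
    burauGen i * burauGen j = burauGen j * burauGen i := by
  ext x k : 3
  simp only [Subgroup.coe_mul, LinearEquiv.mul_apply, burauGen_apply]
  split_ifs <;> first | omega | rfl

lemma burauGen_braid (i : ℕ) : burauGen i * burauGen (i + 1) * burauGen i =
    burauGen (i + 1) * burauGen i * burauGen (i + 1) := by
  ext x k : 3
  simp only [Subgroup.coe_mul, LinearEquiv.mul_apply, burauGen_apply]
  split_ifs <;> first | omega | ring

/-- The Burau representation `η : B_∞ → GL(∞)`. -/
def η : BInf →* GLInf :=
  PresentedGroup.toGroup (f := burauGen) <| by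
    rintro r (⟨i, j, hij, rfl⟩ | ⟨i, rfl⟩)
    · simp only [map_mul, map_inv, FreeGroup.lift_apply_of]
      exact mul_inv_eq_one.2 (burauGen_comm hij)
    · simp only [map_mul, map_inv, FreeGroup.lift_apply_of]
      exact mul_inv_eq_one.2 (burauGen_braid i)

/-! ### Categories of double cosets -/

/-- A well-defined operation on the double cosets of `G` with relation to a family `K` of
subgroups: compatible products `K[r]\G/K[s] × K[s]\G/K[t] → K[r]\G/K[t]` that are associative
and have the classes of the unit element of `G` as units. -/
structure DoubleCosetOperation {G : Type*} [Group G] (K : ℕ → Subgroup G) where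
  /-- the products -/
  mul (r s t : ℕ) : DoubleCoset.Quotient (K r : Set G) (K s) →
    DoubleCoset.Quotient (K s : Set G) (K t) → DoubleCoset.Quotient (K r : Set G) (K t)
  assoc (r s t u : ℕ) (a : DoubleCoset.Quotient (K r : Set G) (K s))
    (b : DoubleCoset.Quotient (K s : Set G) (K t)) (c : DoubleCoset.Quotient (K t : Set G) (K u)) :
    mul r t u (mul r s t a b) c = mul r s u a (mul s t u b c)
  mul_one (t r : ℕ) (a : DoubleCoset.Quotient (K t : Set G) (K r)) :
    mul t r r a (DoubleCoset.mk (K r) (K r) 1) = a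
  one_mul (r t : ℕ) (b : DoubleCoset.Quotient (K r : Set G) (K t)) :
    mul r r t (DoubleCoset.mk (K r) (K r) 1) b = b

/-- The product of double cosets is given by inserting `θ_n[s]` between arbitrary representatives,
for all sufficiently large `n`: `K[r] p K[s] · K[s] q K[t] = K[r] p θ_n[s] q K[t]`. -/
def DoubleCosetOperation.IsLimitProduct {G : Type*} [Group G] {K : ℕ → Subgroup G}
    (μ : DoubleCosetOperation K) (θ : ℕ → ℕ → G) : Prop :=
  ∀ (r s t : ℕ) (p q : G), ∃ N : ℕ, ∀ n : ℕ, N ≤ n →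
    μ.mul r s t (DoubleCoset.mk (K r) (K s) p) (DoubleCoset.mk (K s) (K t) q) =
      DoubleCoset.mk (K r) (K t) (p * θ n s * q)

/-- The objects of the category of double cosets: the nonnegative integers. -/
structure DCosCat {G : Type*} [Group G] {K : ℕ → Subgroup G} (μ : DoubleCosetOperation K) where
  /-- the nonnegative integer -/
  idx : ℕ

/-- The category of double cosets: `Hom(r, s) = K[s]\G/K[r]`, with the given product as
composition. -/
instance {G : Type*} [Group G] {K : ℕ → Subgroup G} (μ : DoubleCosetOperation K) :
    Category (DCosCat μ) where
  Hom r s := DoubleCoset.Quotient (K s.idx : Set G) (K r.idx)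
  id r := DoubleCoset.mk (K r.idx) (K r.idx) 1
  comp {r s t} f g := μ.mul t.idx s.idx r.idx g f
  id_comp f := μ.mul_one _ _ f
  comp_id f := μ.one_mul _ _ f
  assoc f g h := (μ.assoc _ _ _ _ h g f).symm

/-- The morphism `r ⟶ s` given by the double coset `K[s] g K[r]`. -/
def DCosCat.homMk {G : Type*} [Group G] {K : ℕ → Subgroup G} (μ : DoubleCosetOperation K)
    (r s : ℕ) (g : G) : (DCosCat.mk r : DCosCat μ) ⟶ DCosCat.mk s :=
  DoubleCoset.mk (K s) (K r) g

end BurauFunctor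
end

/-! The inserted elements `θ n s` and `Theta n s` are square cases of rectangular block crossings `X
s a b`, in which `a` strands cross the next `b` strands behind `s` fixed ones. A crossing of larger
blocks factors through smaller ones (`add_left`, `add_right`), and every group element commutes with
`K N` for large `N`. These facts, collected in `IsBlockCrossing`, imply all the claims about the
products.

Stabilisation (`mk_add`): enlarging the blocks multiplies `X s a b` on the two sides by elements of
`K (s + a)` and `K (s + b)`. For large `a` and `b` these commute with `p` and `q` and are absorbed
by `K r` and `K t`. Independence of representatives (`mulRep_left`, `mulRep_right`): an element of
`K s` passes through `X s n n` and becomes an element of `K (s + n)`, which disappears in the same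
way. Associativity (`mulRep_assoc`): with suitable rectangular crossings the two bracketings differ
only in the position of a factor that commutes with the middle representative. Units: `X r n n` lies
in `K r`.

For braids, passing through a crossing comes down to the braid relation. For matrices the crossings
are the images under `η`, so their algebra is inherited. Only passing through needs a new argument,
because `GSub s` is not defined by generators: the upper blocks of `Theta n 0` involve the first
coordinates only through the form `v` and the direction `u`, which `fixSub` preserves
(`mul_Theta_zero`, `Theta_zero_mul`). Since `η` maps `BSub s` into `GSub s` and `θ n s` to `Theta n
s`, functoriality follows by comparing both products at one large `n`. -/

namespace BurauFunctor

/-! ### Products of double cosets from block crossings -/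

section DoubleCosets

variable {G : Type*} [Group G]

/-- The element `g` commutes with every element of `K N`. -/
def Centralizes (K : ℕ → Subgroup G) (g : G) (N : ℕ) : Prop :=
  ∀ k ∈ K N, Commute g k

/-- A system of elements `X s a b` with the formal properties of the braids that cross a block of
`a` strands with the adjacent block of `b` strands, behind `s` fixed strands. -/
structure IsBlockCrossing (K : ℕ → Subgroup G) (X : ℕ → ℕ → ℕ → G) : Prop where
  anti : Antitone K
  exists_centralizes (g : G) : ∃ N, Centralizes K g N
  mem (s a b : ℕ) : X s a b ∈ K s
  centralizes (s a b : ℕ) : Centralizes K (X s a b) (s + a + b)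
  add_right (s a b d : ℕ) : X s a (b + d) = X s a b * X (s + b) a d
  add_left (s a c d : ℕ) : X s (a + c) d = X (s + a) c d * X s a d
  push_right (s : ℕ) (h : G) (hh : h ∈ K s) :
    ∃ M, ∀ n, M ≤ n → ∃ h' ∈ K (s + n), h * X s n n = X s n n * h'
  push_left (s : ℕ) (h : G) (hh : h ∈ K s) :
    ∃ M, ∀ n, M ≤ n → ∃ h' ∈ K (s + n), X s n n * h = h' * X s n n

lemma mk_mul_left {H K : Subgroup G} {h : G} (hh : h ∈ H) (g : G) :
    DoubleCoset.mk H K (h * g) = DoubleCoset.mk H K g :=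
  ((DoubleCoset.eq H K _ _).2 ⟨h, hh, 1, K.one_mem, by simp⟩).symm

lemma mk_mul_right {H K : Subgroup G} {k : G} (hk : k ∈ K) (g : G) :
    DoubleCoset.mk H K (g * k) = DoubleCoset.mk H K g :=
  ((DoubleCoset.eq H K _ _).2 ⟨1, H.one_mem, k, hk, by simp⟩).symm

namespace IsBlockCrossing

variable {K : ℕ → Subgroup G} {X : ℕ → ℕ → ℕ → G} (hX : IsBlockCrossing K X)

include hX

lemma centralizes_mono {g : G} {N M : ℕ} (h : Centralizes K g N) (hNM : N ≤ M) :
    Centralizes K g M :=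
  fun k hk => h k (hX.anti hNM hk)

omit hX in
lemma centralizes_mul {g h : G} {N : ℕ} (hg : Centralizes K g N) (hh : Centralizes K h N) :
    Centralizes K (g * h) N :=
  fun k hk => (hg k hk).mul_left (hh k hk)

/-- Splitting the large crossing leaves one surplus factor on each side of `X s a b`. The left one
lies in `K (s + a)` and moves out past `p`, the right one lies in `K (s + b)` and moves out past
`q`; the outer subgroups absorb them. -/
lemma mk_add {r s t a b : ℕ} {p q : G} (hp : Centralizes K p (s + a)) (hr : r ≤ s + a)
    (hq : Centralizes K q (s + b)) (ht : t ≤ s + b) (a' b' : ℕ) :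
    DoubleCoset.mk (K r) (K t) (p * X s (a + a') (b + b') * q) =
      DoubleCoset.mk (K r) (K t) (p * X s a b * q) := by
  have h1 := hX.mem (s + a) a' (b + b')
  have h2 := hX.mem (s + b) a b'
  rw [hX.add_left, hX.add_right s a b b']
  have : p * (X (s + a) a' (b + b') * (X s a b * X (s + b) a b')) * q =
      X (s + a) a' (b + b') * (p * X s a b * q * X (s + b) a b') := by
    simp only [mul_assoc]
    rw [(hq _ h2).eq, ← mul_assoc p, (hp _ h1).eq, mul_assoc]
  rw [this, mk_mul_left (hX.anti hr h1), mk_mul_right (hX.anti ht h2)]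

lemma exists_size (s r : ℕ) (g : G) : ∃ a, Centralizes K g (s + a) ∧ r ≤ s + a := by
  obtain ⟨N, hN⟩ := hX.exists_centralizes g
  exact ⟨N + r, hX.centralizes_mono hN (by omega), by omega⟩

/-- The product of the double cosets of `p` and `q`. -/
noncomputable def mulRep (r s t : ℕ) (p q : G) : DoubleCoset.Quotient (K r : Set G) (K t) :=
  DoubleCoset.mk (K r) (K t)
    (p * X s (hX.exists_size s r p).choose (hX.exists_size s t q).choose * q)

lemma mulRep_eq {r s t a b : ℕ} {p q : G} (hp : Centralizes K p (s + a)) (hr : r ≤ s + a)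
    (hq : Centralizes K q (s + b)) (ht : t ≤ s + b) :
    hX.mulRep r s t p q = DoubleCoset.mk (K r) (K t) (p * X s a b * q) := by
  obtain ⟨h1, h2⟩ := (hX.exists_size s r p).choose_spec
  obtain ⟨h3, h4⟩ := (hX.exists_size s t q).choose_spec
  -- The chosen sizes and the given ones are both compared with their sums.
  rw [mulRep, ← hX.mk_add h1 h2 h3 h4 a b, add_comm _ a, add_comm _ b, hX.mk_add hp hr hq ht]

lemma exists_mulRep_eq (r s t : ℕ) (p q : G) : ∃ N, ∀ n, N ≤ n →
    hX.mulRep r s t p q = DoubleCoset.mk (K r) (K t) (p * X s n n * q) := by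
  obtain ⟨a, h1, h2⟩ := hX.exists_size s r p
  obtain ⟨b, h3, h4⟩ := hX.exists_size s t q
  exact ⟨max a b, fun n hn => hX.mulRep_eq (hX.centralizes_mono h1 (by omega)) (by omega)
    (hX.centralizes_mono h3 (by omega)) (by omega)⟩

/-- For large `n` the factor `h` emerges behind `X s n n` as an element of `K (s + n)`, which
commutes with `q` and is absorbed by `K t`. -/
lemma mulRep_left (r s t : ℕ) (p q : G) {k h : G} (hk : k ∈ K r) (hh : h ∈ K s) :
    hX.mulRep r s t (k * p * h) q = hX.mulRep r s t p q := by
  obtain ⟨N₁, h₁⟩ := hX.exists_mulRep_eq r s t (k * p * h) q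
  obtain ⟨N₂, h₂⟩ := hX.exists_mulRep_eq r s t p q
  obtain ⟨N₃, h₃⟩ := hX.push_right s h hh
  obtain ⟨b, h₄, h₅⟩ := hX.exists_size s t q
  let n := max (max N₁ N₂) (max N₃ b)
  obtain ⟨h', hh', e⟩ := h₃ n (by omega)
  rw [h₁ n (by omega), h₂ n (by omega)]
  have : k * p * h * X s n n * q = k * (p * X s n n * q * h') := by
    rw [mul_assoc (k * p), e]
    simp only [mul_assoc]
    rw [(hX.centralizes_mono h₄ (by omega) h' hh').eq]
  rw [this, mk_mul_left hk, mk_mul_right (hX.anti (by omega) hh')]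

lemma mulRep_right (r s t : ℕ) (p q : G) {k h : G} (hk : k ∈ K t) (hh : h ∈ K s) :
    hX.mulRep r s t p (h * q * k) = hX.mulRep r s t p q := by
  obtain ⟨N₁, h₁⟩ := hX.exists_mulRep_eq r s t p (h * q * k)
  obtain ⟨N₂, h₂⟩ := hX.exists_mulRep_eq r s t p q
  obtain ⟨N₃, h₃⟩ := hX.push_left s h hh
  obtain ⟨b, h₄, h₅⟩ := hX.exists_size s r p
  let n := max (max N₁ N₂) (max N₃ b)
  obtain ⟨h', hh', e⟩ := h₃ n (by omega)
  rw [h₁ n (by omega), h₂ n (by omega)]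
  have : p * X s n n * (h * q * k) = h' * (p * X s n n * q) * k := by
    rw [← mul_assoc h', ← mul_assoc h' p, ← (hX.centralizes_mono h₄ (by omega) h' hh').eq,
      mul_assoc p h', ← e]
    simp only [mul_assoc]
  rw [this, mk_mul_right hk, mk_mul_left (hX.anti (by omega) hh')]

/-- The representatives `g` and `h` are exposed because `mulRep` acts on group elements, while its
value is only a double coset. -/
lemma mulRep_assoc (r s t u : ℕ) (p q w : G) : ∃ g h : G,
    hX.mulRep r s t p q = DoubleCoset.mk _ _ g ∧ hX.mulRep s t u q w = DoubleCoset.mk _ _ h ∧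
      hX.mulRep r t u g w = hX.mulRep r s u p h := by
  obtain ⟨N₁, h₁⟩ := hX.exists_centralizes p
  obtain ⟨N₂, h₂⟩ := hX.exists_centralizes q
  obtain ⟨N₃, h₃⟩ := hX.exists_centralizes w
  obtain ⟨N, hN⟩ : ∃ N, N₁ + N₂ + N₃ + r + s + t + u ≤ N := ⟨_, le_rfl⟩
  have cp (M : ℕ) (hM : N ≤ M) : Centralizes K p M := hX.centralizes_mono h₁ (by omega)
  have cq (M : ℕ) (hM : N ≤ M) : Centralizes K q M := hX.centralizes_mono h₂ (by omega)
  have cw (M : ℕ) (hM : N ≤ M) : Centralizes K w M := hX.centralizes_mono h₃ (by omega)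
  -- The sizes `t + N` and `s + N` make `s + (t + N)` and `t + (s + N)` agree. Both outer products
  -- then contain the same surplus factor `X (s + (t + N)) N N`, before `q` in one and after it in
  -- the other.
  refine ⟨p * X s N (t + N) * q, q * X t (s + N) N * w,
    hX.mulRep_eq (cp _ (by omega)) (by omega) (cq _ (by omega)) (by omega),
    hX.mulRep_eq (cq _ (by omega)) (by omega) (cw _ (by omega)) (by omega), ?_⟩
  rw [hX.mulRep_eq (a := s + N + N) (b := N) (centralizes_mul (centralizes_mul
      (cp _ (by omega)) (hX.centralizes_mono (hX.centralizes s N (t + N)) (by omega)))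
      (cq _ (by omega))) (by omega) (cw _ (by omega)) (by omega),
    hX.mulRep_eq (a := N) (b := t + N + N) (cp _ (by omega)) (by omega)
      (centralizes_mul (centralizes_mul (cq _ (by omega))
      (hX.centralizes_mono (hX.centralizes t (s + N) N) (by omega))) (cw _ (by omega)))
      (by omega), hX.add_left t (s + N) N, hX.add_right s N (t + N) N]
  rw [show t + (s + N) = s + (t + N) by omega]
  have := (cq (s + (t + N)) (by omega) _ (hX.mem (s + (t + N)) N N)).eq
  congr 1
  simp only [← mul_assoc]
  rw [mul_assoc _ q, this, ← mul_assoc]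

/-- The operation on double cosets given by a system of block crossings. -/
noncomputable def operation : DoubleCosetOperation K where
  mul r s t := Quotient.lift₂ (hX.mulRep r s t) <| by
    rintro p q p' q' hp hq
    obtain ⟨k, hk, h, hh, rfl⟩ := DoubleCoset.rel_iff.1 hp
    obtain ⟨k', hk', h', hh', rfl⟩ := DoubleCoset.rel_iff.1 hq
    rw [hX.mulRep_left r s t _ _ hk hh, hX.mulRep_right r s t _ _ hh' hk']
  assoc r s t u a b c := by
    induction a using Quotient.inductionOn with | _ p
    induction b using Quotient.inductionOn with | _ q
    induction c using Quotient.inductionOn with | _ w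
    obtain ⟨g, h, hg, hh, e⟩ := hX.mulRep_assoc r s t u p q w
    rw [Quotient.lift₂_mk, Quotient.lift₂_mk, hg, hh]
    exact e
  mul_one t r a := by
    induction a using Quotient.inductionOn with | _ p
    obtain ⟨N, hN⟩ := hX.exists_mulRep_eq t r r p 1
    refine (hN N le_rfl).trans ?_
    rw [_root_.mul_one, mk_mul_right (hX.mem r N N)]
  one_mul r t b := by
    induction b using Quotient.inductionOn with | _ p
    obtain ⟨N, hN⟩ := hX.exists_mulRep_eq r r t 1 p
    refine (hN N le_rfl).trans ?_
    rw [_root_.one_mul, mk_mul_left (hX.mem r N N)]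

lemma operation_isLimitProduct {θ : ℕ → ℕ → G} (h : ∀ n s, X s n n = θ n s) :
    hX.operation.IsLimitProduct θ := by
  intro r s t p q
  obtain ⟨N, hN⟩ := hX.exists_mulRep_eq r s t p q
  exact ⟨N, fun n hn => by rw [← h]; exact hN n hn⟩

end IsBlockCrossing

/-- A homomorphism that respects the subgroups and the inserted elements induces a functor between
the categories of double cosets. -/
def DCosCat.functor {G' : Type*} [Group G'] {K : ℕ → Subgroup G} {K' : ℕ → Subgroup G'}
    {μ : DoubleCosetOperation K} {μ' : DoubleCosetOperation K'} {θ : ℕ → ℕ → G}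
    {θ' : ℕ → ℕ → G'} (hμ : μ.IsLimitProduct θ) (hμ' : μ'.IsLimitProduct θ') (f : G →* G')
    (hK : ∀ s, ∀ g ∈ K s, f g ∈ K' s) (hθ : ∀ n s, f (θ n s) = θ' n s) :
    DCosCat μ ⥤ DCosCat μ' where
  obj r := ⟨r.idx⟩
  map {r s} := Quotient.lift (fun p => DoubleCoset.mk (K' s.idx) (K' r.idx) (f p)) <| by
    intro p q h
    obtain ⟨k, hk, l, hl, rfl⟩ := DoubleCoset.rel_iff.1 h
    rw [map_mul, map_mul, mk_mul_right (hK _ _ hl), mk_mul_left (hK _ _ hk)]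
  map_id r := congrArg (DoubleCoset.mk (K' r.idx) (K' r.idx)) (map_one f)
  map_comp {r s t} x y := by
    induction x using Quotient.inductionOn with | _ p
    induction y using Quotient.inductionOn with | _ q
    obtain ⟨N, hN⟩ := hμ t.idx s.idx r.idx q p
    obtain ⟨N', hN'⟩ := hμ' t.idx s.idx r.idx (f q) (f p)
    -- Both limits are read off at a common index, where `f` carries one inserted element to the
    -- other.
    have e := hN (max N N') (le_max_left _ _)
    have e' := hN' (max N N') (le_max_right _ _)
    rw [← hθ, ← map_mul, ← map_mul] at e'
    exact (congrArg _ e).trans e'.symm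

end DoubleCosets

/-! ### Block crossings in the braid group -/

lemma σ_comm {i j : ℕ} (h : i + 2 ≤ j) : Commute (σ i) (σ j) := by
  have := PresentedGroup.one_of_mem (rels := braidRels) (Or.inl ⟨i, j, h, rfl⟩)
  rw [map_mul, map_inv, mul_inv_eq_one] at this
  exact this

lemma σ_braid (i : ℕ) : σ i * σ (i + 1) * σ i = σ (i + 1) * σ i * σ (i + 1) := by
  have := PresentedGroup.one_of_mem (rels := braidRels) (Or.inr ⟨i, rfl⟩)
  rw [map_mul, map_inv, mul_inv_eq_one] at this
  exact this

lemma BSub_antitone : Antitone BSub := fun _ _ h =>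
  Subgroup.closure_mono fun _ ⟨i, hi, e⟩ => ⟨i, h.trans hi, e⟩

lemma σ_mem {s i : ℕ} (h : s ≤ i) : σ i ∈ BSub s :=
  Subgroup.subset_closure ⟨i, h, rfl⟩

lemma centralizes_σ (i : ℕ) : Centralizes BSub (σ i) (i + 2) := by
  intro k hk
  induction hk using Subgroup.closure_induction with
  | mem x hx => obtain ⟨j, hj, rfl⟩ := hx; exact σ_comm hj
  | one => exact Commute.one_right _
  | mul x y _ _ hx hy => exact hx.mul_right hy
  | inv x _ hx => exact hx.inv_right

lemma centralizes_BSub_mono {g : BInf} {N M : ℕ} (h : Centralizes BSub g N) (hNM : N ≤ M) :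
    Centralizes BSub g M :=
  fun k hk => h k (BSub_antitone hNM hk)

lemma exists_centralizes_BSub (g : BInf) : ∃ N, Centralizes BSub g N := by
  have hg : g ∈ Subgroup.closure (Set.range (PresentedGroup.of (rels := braidRels))) := by
    rw [PresentedGroup.closure_range_of]; trivial
  induction hg using Subgroup.closure_induction with
  | mem x hx => obtain ⟨i, rfl⟩ := hx; exact ⟨i + 2, centralizes_σ i⟩
  | one => exact ⟨0, fun k _ => Commute.one_left k⟩
  | mul x y _ _ hx hy =>
    obtain ⟨N, hN⟩ := hx
    obtain ⟨M, hM⟩ := hy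
    exact ⟨max N M, fun k hk => (centralizes_BSub_mono hN (le_max_left N M) k hk).mul_left
      (centralizes_BSub_mono hM (le_max_right N M) k hk)⟩
  | inv x _ hx =>
    obtain ⟨N, hN⟩ := hx
    exact ⟨N, fun k hk => (hN k hk).inv_left⟩

/-- The braid `σ (s + a - 1) ⋯ σ s` that crosses a block of `a` strands with one strand. -/
def strandCrossing (s : ℕ) : ℕ → BInf
  | 0 => 1
  | a + 1 => σ (s + a) * strandCrossing s a

/-- The braid that crosses a block of `a` strands with a block of `b` strands. -/
def blockCrossing (s a : ℕ) : ℕ → BInf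
  | 0 => 1
  | b + 1 => blockCrossing s a b * strandCrossing (s + b) a

lemma strandCrossing_mem (s a : ℕ) : strandCrossing s a ∈ BSub s := by
  induction a with
  | zero => exact one_mem _
  | succ a ih => exact mul_mem (σ_mem (by omega)) ih

lemma blockCrossing_mem (s a b : ℕ) : blockCrossing s a b ∈ BSub s := by
  induction b with
  | zero => exact one_mem _
  | succ b ih => exact mul_mem ih (BSub_antitone (by omega) (strandCrossing_mem (s + b) a))

lemma centralizes_strandCrossing (s a : ℕ) : Centralizes BSub (strandCrossing s a) (s + a + 1) := by
  induction a with
  | zero => exact fun k _ => Commute.one_left k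
  | succ a ih =>
    exact fun k hk => (centralizes_σ (s + a) k (BSub_antitone (by omega) hk)).mul_left
      (ih k (BSub_antitone (by omega) hk))

lemma centralizes_blockCrossing (s a b : ℕ) :
    Centralizes BSub (blockCrossing s a b) (s + a + b) := by
  induction b with
  | zero => exact fun k _ => Commute.one_left k
  | succ b ih =>
    exact fun k hk => (ih k (BSub_antitone (by omega) hk)).mul_left
      (centralizes_strandCrossing (s + b) a k (BSub_antitone (by omega) hk))

lemma strandCrossing_add (s a c : ℕ) :
    strandCrossing s (a + c) = strandCrossing (s + a) c * strandCrossing s a := by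
  induction c with
  | zero => rw [add_zero, strandCrossing, one_mul]
  | succ c ih => rw [← add_assoc, strandCrossing, strandCrossing, ih, mul_assoc, add_assoc s]

lemma blockCrossing_add_right (s a b d : ℕ) :
    blockCrossing s a (b + d) = blockCrossing s a b * blockCrossing (s + b) a d := by
  induction d with
  | zero => rw [add_zero, blockCrossing, mul_one]
  | succ d ih => rw [← add_assoc, blockCrossing, blockCrossing, ih, mul_assoc, add_assoc s]

/-- The recursion runs over the right block, so splitting the left block takes an induction in which
the strand crossing of the last `c` strands commutes past `blockCrossing s a d`, being supported
behind it. -/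
lemma blockCrossing_add_left (s a c d : ℕ) :
    blockCrossing s (a + c) d = blockCrossing (s + a) c d * blockCrossing s a d := by
  induction d with
  | zero => rw [blockCrossing, blockCrossing, blockCrossing, mul_one]
  | succ d ih =>
    rw [blockCrossing, blockCrossing, blockCrossing, ih, strandCrossing_add,
      add_right_comm s d a, mul_assoc, mul_assoc, ← mul_assoc (blockCrossing s a d),
      (centralizes_blockCrossing s a d _ (strandCrossing_mem _ _)).eq, mul_assoc]

/-- One braid relation settles the crossing of `i + 2` strands; the remaining factors of the longer
crossing start at index `s + i + 2` and commute with `σ (s + i)`. -/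
lemma σ_mul_strandCrossing (s : ℕ) {i a : ℕ} (h : i + 1 < a) :
    σ (s + i) * strandCrossing s a = strandCrossing s a * σ (s + i + 1) := by
  obtain ⟨c, rfl⟩ := Nat.exists_eq_add_of_lt h
  have h1 : σ (s + i) * strandCrossing s (i + 2) = strandCrossing s (i + 2) * σ (s + i + 1) := by
    rw [strandCrossing, strandCrossing, ← add_assoc s i 1, ← mul_assoc, ← mul_assoc, σ_braid,
      mul_assoc, mul_assoc, mul_assoc, mul_assoc]
    congr 2
    exact (centralizes_strandCrossing s i _ (σ_mem le_rfl)).eq.symm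
  rw [show i + 1 + c + 1 = i + 2 + c by omega, strandCrossing_add, ← mul_assoc,
    (centralizes_σ (s + i) _ (BSub_antitone (by omega) (strandCrossing_mem (s + (i + 2)) c))).eq,
    mul_assoc, h1, mul_assoc]

lemma σ_mul_blockCrossing (s b : ℕ) {i a : ℕ} (h : i + 1 < a) :
    σ (s + i) * blockCrossing s a b = blockCrossing s a b * σ (s + i + b) := by
  induction b with
  | zero => rw [blockCrossing, mul_one, one_mul, add_zero]
  | succ b ih =>
    rw [blockCrossing, ← mul_assoc, ih, mul_assoc, mul_assoc, add_right_comm s i b,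
      σ_mul_strandCrossing (s + b) h,
      show s + b + i + 1 = s + i + (b + 1) by omega]

lemma blockCrossing_one_succ (s b : ℕ) :
    blockCrossing s 1 (b + 1) = blockCrossing s 1 b * σ (s + b) := by
  rw [blockCrossing, strandCrossing, strandCrossing, mul_one, add_zero]

/-- The mirror image: `blockCrossing s 1 b` is the ascending product of the `σ (s + m)` with `m <
b`, so the braid relation is used in the other direction. -/
lemma σ_mul_blockCrossing_one (s : ℕ) {i b : ℕ} (h : i + 1 < b) :
    σ (s + i + 1) * blockCrossing s 1 b = blockCrossing s 1 b * σ (s + i) := by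
  obtain ⟨d, rfl⟩ := Nat.exists_eq_add_of_lt h
  have h1 : σ (s + i + 1) * blockCrossing s 1 (i + 2) = blockCrossing s 1 (i + 2) * σ (s + i) := by
    rw [blockCrossing_one_succ, blockCrossing_one_succ, ← mul_assoc, ← mul_assoc,
      ← (centralizes_blockCrossing s 1 i (σ (s + i + 1)) (σ_mem (by omega))).eq, mul_assoc,
      mul_assoc, ← mul_assoc (σ (s + i + 1)), ← add_assoc s i 1, ← σ_braid]
    simp only [mul_assoc]
  rw [show i + 1 + d + 1 = i + 2 + d by omega, blockCrossing_add_right, ← mul_assoc, h1,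
    mul_assoc, mul_assoc,
    (centralizes_σ (s + i) _ (BSub_antitone (by omega) (blockCrossing_mem (s + (i + 2)) 1 d))).eq]

lemma σ_mul_blockCrossing' (s a : ℕ) {i b : ℕ} (h : i + 1 < b) :
    σ (s + i + a) * blockCrossing s a b = blockCrossing s a b * σ (s + i) := by
  induction a with
  | zero =>
    have h0 : blockCrossing s 0 b = 1 := by
      clear h
      induction b with
      | zero => rfl
      | succ b ih => rw [blockCrossing, ih, strandCrossing, one_mul]
    rw [h0, mul_one, one_mul, add_zero]
  | succ a ih =>
    rw [blockCrossing_add_left, ← mul_assoc, ← add_assoc, add_right_comm s i a,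
      σ_mul_blockCrossing_one (s + a) h, mul_assoc, add_right_comm s a i, ih, mul_assoc]

lemma blockCrossing_eq_θ (n s : ℕ) : blockCrossing s n n = θ n s := by
  have h1 (s a : ℕ) : ((List.range a).reverse.map fun m => σ (s + m)).prod =
      strandCrossing s a := by
    induction a with
    | zero => rfl
    | succ a ih => rw [List.range_succ, List.reverse_concat, List.map_cons, List.prod_cons, ih,
        strandCrossing]
  have h2 (b : ℕ) : blockCrossing s n b = ((List.range b).map fun i => τ s n i).prod := by
    induction b with
    | zero => rfl
    | succ b ih => rw [List.range_succ, List.map_append, List.prod_append, ← ih, List.map_singleton,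
        List.prod_singleton, τ, h1, blockCrossing]
  exact h2 n

lemma blockCrossing_push_right (s : ℕ) (h : BInf) (hh : h ∈ BSub s) : ∃ M, ∀ n, M ≤ n →
    ∃ h' ∈ BSub (s + n), h * blockCrossing s n n = blockCrossing s n n * h' := by
  induction hh using Subgroup.closure_induction with
  | mem x hx =>
    obtain ⟨j, hj, rfl⟩ := hx
    obtain ⟨i, rfl⟩ := Nat.exists_eq_add_of_le hj
    -- Both strands of the generator, at offsets `i` and `i + 1`, must belong to the block of `n`
    -- strands.
    exact ⟨i + 2, fun n hn => ⟨σ (s + i + n), σ_mem (by omega),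
      σ_mul_blockCrossing s n (by omega)⟩⟩
  | one => exact ⟨0, fun n _ => ⟨1, one_mem _, by rw [one_mul, mul_one]⟩⟩
  | mul x y _ _ hx hy =>
    obtain ⟨M, hM⟩ := hx
    obtain ⟨N, hN⟩ := hy
    refine ⟨max M N, fun n hn => ?_⟩
    obtain ⟨x', hx', ex⟩ := hM n (by omega)
    obtain ⟨y', hy', ey⟩ := hN n (by omega)
    exact ⟨x' * y', mul_mem hx' hy', by rw [mul_assoc, ey, ← mul_assoc, ex, mul_assoc]⟩
  | inv x _ hx =>
    obtain ⟨M, hM⟩ := hx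
    refine ⟨M, fun n hn => ?_⟩
    obtain ⟨x', hx', ex⟩ := hM n hn
    exact ⟨x'⁻¹, inv_mem hx', by rw [inv_mul_eq_iff_eq_mul, ← mul_assoc, ex, mul_inv_cancel_right]⟩

lemma blockCrossing_push_left (s : ℕ) (h : BInf) (hh : h ∈ BSub s) : ∃ M, ∀ n, M ≤ n →
    ∃ h' ∈ BSub (s + n), blockCrossing s n n * h = h' * blockCrossing s n n := by
  induction hh using Subgroup.closure_induction with
  | mem x hx =>
    obtain ⟨j, hj, rfl⟩ := hx
    obtain ⟨i, rfl⟩ := Nat.exists_eq_add_of_le hj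
    exact ⟨i + 2, fun n hn => ⟨σ (s + i + n), σ_mem (by omega),
      (σ_mul_blockCrossing' s n (by omega)).symm⟩⟩
  | one => exact ⟨0, fun n _ => ⟨1, one_mem _, by rw [one_mul, mul_one]⟩⟩
  | mul x y _ _ hx hy =>
    obtain ⟨M, hM⟩ := hx
    obtain ⟨N, hN⟩ := hy
    refine ⟨max M N, fun n hn => ?_⟩
    obtain ⟨x', hx', ex⟩ := hM n (by omega)
    obtain ⟨y', hy', ey⟩ := hN n (by omega)
    exact ⟨x' * y', mul_mem hx' hy', by rw [← mul_assoc, ex, mul_assoc, ey, mul_assoc]⟩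
  | inv x _ hx =>
    obtain ⟨M, hM⟩ := hx
    refine ⟨M, fun n hn => ?_⟩
    obtain ⟨x', hx', ex⟩ := hM n hn
    exact ⟨x'⁻¹, inv_mem hx', by rw [mul_inv_eq_iff_eq_mul, mul_assoc, ex, inv_mul_cancel_left]⟩

lemma isBlockCrossing_blockCrossing : IsBlockCrossing BSub blockCrossing where
  anti := BSub_antitone
  exists_centralizes := exists_centralizes_BSub
  mem := blockCrossing_mem
  centralizes := centralizes_blockCrossing
  add_right := blockCrossing_add_right
  add_left := blockCrossing_add_left
  push_right := blockCrossing_push_right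
  push_left := blockCrossing_push_left

end BurauFunctor

namespace BurauFunctor

/-! ### Block crossings in `GL(∞)` -/

lemma GLInf.ext_apply {g h : GLInf} (H : ∀ x k, (g : AutFree) x k = (h : AutFree) x k) : g = h := by
  ext x k : 3
  exact H x k

lemma IsFinitary.apply_of_vanish {N : ℕ} {g : AutFree} (hg : IsFinitary N g) {w : ℕ →₀ R}
    (hw : ∀ k, k < N → w k = 0) : g w = w := by
  conv_rhs => rw [← w.sum_single]
  conv_lhs => rw [← w.sum_single]
  rw [Finsupp.sum, map_sum]
  refine Finset.sum_congr rfl fun i hi => ?_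
  have hiN : N ≤ i := by
    by_contra h
    exact Finsupp.mem_support_iff.1 hi (hw i (by omega))
  rw [← mul_one (w i), ← smul_eq_mul, ← Finsupp.smul_single, map_smul,
    (isFinitary_iff.1 hg).1 i hiN]

/-- An element of `GSub N` changes a vector only by something vanishing on the first `N`
coordinates, and `g` fixes such vectors. -/
lemma centralizes_GSub {N : ℕ} {g : GLInf} (hg : IsFinitary N (g : AutFree)) :
    Centralizes GSub g N := by
  rintro _ ⟨Y, -, rfl⟩
  refine GLInf.ext_apply fun x k => ?_
  rw [Subgroup.coe_mul, Subgroup.coe_mul, LinearEquiv.mul_apply, LinearEquiv.mul_apply]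
  have h1 : (g : AutFree) ((shift N Y : AutFree) x) =
      (g : AutFree) x + ((shift N Y : AutFree) x - x) := by
    rw [← sub_eq_iff_eq_add', ← map_sub]
    refine hg.apply_of_vanish fun k hk => ?_
    rw [Finsupp.sub_apply, shift_apply, if_pos hk, sub_self]
  have h2 : (split N ((g : AutFree) x)).2 = (split N x).2 := by
    ext1 i
    rw [split_snd, split_snd, (isFinitary_iff.1 hg).2 _ (by omega)]
  rw [h1, Finsupp.add_apply, Finsupp.sub_apply, shift_apply, shift_apply]
  split_ifs with hk
  · rw [sub_self, add_zero]
  · rw [h2, (isFinitary_iff.1 hg).2 k (by omega), add_sub_cancel]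

lemma isFinitary_shift (n : ℕ) {N : ℕ} {X : GLInf} (hX : IsFinitary N (X : AutFree)) :
    IsFinitary (n + N) (shift n X : AutFree) :=
  isFinitary_blockAut n 1 hX

lemma shift_shift (n m : ℕ) (X : GLInf) : shift n (shift m X) = shift (n + m) X := by
  refine GLInf.ext_apply fun x k => ?_
  rw [shift_apply, shift_apply, shift_apply]
  split_ifs with h1 h2 h3 h3 h4
  · rfl
  · omega
  · rw [split_snd, Nat.add_sub_cancel' (by omega)]
  · omega
  · omega
  · rw [Nat.sub_sub]
    congr 2
    ext1 i
    rw [split_snd, split_snd, split_snd, add_assoc]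

lemma uTrunc_apply (N i : ℕ) : uTrunc N i = if i < N then 1 else 0 := by
  simp [uTrunc, Finsupp.finsetSum_apply, Finsupp.single_apply]

/-- The linear form with coefficients `v`. -/
noncomputable abbrev vForm : (ℕ →₀ R) →ₗ[R] R := Finsupp.linearCombination R v

lemma vForm_eq_sum {N : ℕ} {x : ℕ →₀ R} (hx : ∀ k, N ≤ k → x k = 0) :
    vForm x = ∑ m ∈ Finset.range N, t ^ m * x m := by
  rw [vForm, Finsupp.linearCombination_apply, Finsupp.sum_of_support_subset (s := Finset.range N)]
  · exact Finset.sum_congr rfl fun i _ => mul_comm _ _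
  · intro k hk
    rw [Finset.mem_range]
    by_contra h
    exact Finsupp.mem_support_iff.1 hk (hx k (by omega))
  · intro i _
    rw [zero_smul]

/-- Reduces invariance of `v` and `u` under `shift n X` to that under `X`: the displacement is a
translate by `n`, on which `vForm` is merely rescaled by `t ^ n`. -/
lemma shift_sub_self (n : ℕ) (X : GLInf) (x : ℕ →₀ R) : (shift n X : AutFree) x - x =
    ((X : AutFree) (split n x).2 - (split n x).2).mapDomain (n + ·) := by
  ext1 k
  rw [Finsupp.sub_apply, shift_apply]
  split_ifs with hk
  · rw [sub_self, Finsupp.mapDomain_of_notMem_range]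
    rintro ⟨m, hm⟩
    simp only at hm
    omega
  · obtain ⟨m, rfl⟩ := Nat.exists_eq_add_of_le (not_lt.1 hk)
    rw [Finsupp.mapDomain_apply (add_right_injective n) _ m, Nat.add_sub_cancel_left,
      Finsupp.sub_apply, split_snd]

lemma vForm_mapDomain (n : ℕ) (x : ℕ →₀ R) : vForm (x.mapDomain (n + ·)) = t ^ n * vForm x := by
  rw [vForm, Finsupp.linearCombination_mapDomain, Finsupp.linearCombination_apply,
    Finsupp.linearCombination_apply, Finsupp.sum, Finsupp.sum, Finset.mul_sum]
  refine Finset.sum_congr rfl fun i _ => ?_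
  rw [Function.comp_apply, v, v, smul_eq_mul, smul_eq_mul, pow_add]
  ring

lemma vForm_apply_of_mem {X : GLInf} (hX : X ∈ fixSub) (x : ℕ →₀ R) :
    vForm ((X : AutFree) x) = vForm x :=
  LinearMap.congr_fun ((rowMul_eq_iff v X).1 hX.1) x

lemma apply_uTrunc_of_mem {X : GLInf} (hX : X ∈ fixSub) {N : ℕ} (hN : IsFinitary N (X : AutFree)) :
    (X : AutFree) (uTrunc N) = uTrunc N :=
  (mulCol_u_eq_iff hN).1 hX.2

lemma shift_mem_fixSub (n : ℕ) {X : GLInf} (hX : X ∈ fixSub) : shift n X ∈ fixSub := by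
  refine ⟨(rowMul_eq_iff v _).2 (LinearMap.ext fun x => ?_), ?_⟩
  · change vForm ((shift n X : AutFree) x) = vForm x
    rw [← sub_eq_zero, ← map_sub, shift_sub_self, vForm_mapDomain, map_sub,
      vForm_apply_of_mem hX, sub_self, mul_zero]
  · obtain ⟨N, hN⟩ := X.2
    refine (mulCol_u_eq_iff (isFinitary_shift n hN)).2 ?_
    rw [← sub_eq_zero, shift_sub_self]
    have : (split n (uTrunc (n + N))).2 = uTrunc N := by
      ext1 i
      rw [split_snd, uTrunc_apply, uTrunc_apply]
      simp
    rw [this, apply_uTrunc_of_mem hX hN, sub_self, Finsupp.mapDomain_zero]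

lemma shift_mem_GSub {m n : ℕ} (h : m ≤ n) {X : GLInf} (hX : X ∈ fixSub) :
    shift n X ∈ GSub m := by
  obtain ⟨k, rfl⟩ := Nat.exists_eq_add_of_le h
  exact ⟨shift k X, shift_mem_fixSub k hX, shift_shift m k X⟩

lemma GSub_antitone : Antitone GSub := by
  rintro m n h _ ⟨X, hX, rfl⟩
  exact shift_mem_GSub h hX

/-! ### Burau images of the braid subgroups and of the crossings -/

lemma burauGen_mem_fixSub : burauGen 0 ∈ fixSub := by
  have h : IsFinitary 2 (burauGen 0 : AutFree) := by
    refine isFinitary_iff.2 ⟨fun j hj => ?_, fun i hi x => ?_⟩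
    · ext1 k
      rw [burauGen_apply, Finsupp.single_eq_of_ne (by omega), Finsupp.single_eq_of_ne (by omega)]
      split_ifs with h1 h2
      · rw [h1, Finsupp.single_eq_of_ne (by omega)]; ring
      · rw [h2, Finsupp.single_eq_of_ne (by omega)]
      · rfl
    · rw [burauGen_apply, if_neg (by omega), if_neg (by omega)]
  refine ⟨(rowMul_eq_iff v _).2 (LinearMap.ext fun x => ?_), (mulCol_u_eq_iff h).2 ?_⟩
  · change vForm ((burauGen 0 : AutFree) x) = vForm x
    rw [← sub_eq_zero, ← map_sub, vForm_eq_sum (N := 2)]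
    · simp only [Finset.sum_range_succ, Finset.sum_range_zero, Finsupp.sub_apply, burauGen_apply]
      simp
      ring
    · intro k hk
      rw [Finsupp.sub_apply, burauGen_apply, if_neg (by omega), if_neg (by omega), sub_self]
  · ext1 k
    rw [burauGen_apply, uTrunc_apply, uTrunc_apply, uTrunc_apply]
    rcases k with _ | _ | k <;> simp

lemma burauGen_mem_GSub {s i : ℕ} (h : s ≤ i) : burauGen i ∈ GSub s := by
  have : burauGen i = shift i (burauGen 0) := by
    rw [burauGen, burauGen, shift_shift, add_zero]
  rw [this]
  exact shift_mem_GSub h burauGen_mem_fixSub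

lemma η_σ (i : ℕ) : η (σ i) = burauGen i :=
  PresentedGroup.toGroup.of _

lemma η_mem_GSub (s : ℕ) : ∀ g ∈ BSub s, η g ∈ GSub s := by
  intro g hg
  induction hg using Subgroup.closure_induction with
  | mem x hx => obtain ⟨i, hi, rfl⟩ := hx; rw [η_σ]; exact burauGen_mem_GSub hi
  | one => rw [map_one]; exact one_mem _
  | mul x y _ _ hx hy => rw [map_mul]; exact mul_mem hx hy
  | inv x _ hx => rw [map_inv]; exact inv_mem hx

lemma η_strandCrossing_apply (s a : ℕ) (x : ℕ →₀ R) (k : ℕ) :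
    (η (strandCrossing s a) : AutFree) x k =
      if k < s then x k else if k < s + a then (1 - t) * x s + t * x (k + 1)
        else if k = s + a then x s else x k := by
  induction a generalizing k with
  | zero =>
    rw [strandCrossing, map_one]
    change x k = _
    split_ifs <;> first | omega | rfl | congr 1
  | succ a ih =>
    rw [strandCrossing, map_mul, η_σ, Subgroup.coe_mul, LinearEquiv.mul_apply, burauGen_apply,
      ih, ih, ih]
    split_ifs <;> first | omega | rfl | (subst_vars; rfl)

/-- In the induction on `b` the new strand crossing acts on `x` first. It leaves the coordinates
already summed unchanged and replaces `x (k + b)` by `(1 - t) * x (s + b) + t * x (k + b + 1)`,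
which supplies the next term of the sum. -/
lemma η_blockCrossing_apply (s a b : ℕ) (x : ℕ →₀ R) (k : ℕ) :
    (η (blockCrossing s a b) : AutFree) x k =
      if k < s then x k
      else if k < s + a then
        (1 - t) * ∑ m ∈ Finset.range b, t ^ m * x (s + m) + t ^ b * x (k + b)
      else if k < s + a + b then x (k - a) else x k := by
  induction b generalizing x k with
  | zero =>
    rw [blockCrossing, map_one]
    change x k = _
    rw [Finset.sum_range_zero]
    split_ifs <;> first | omega | rfl | (rw [add_zero]; ring)
  | succ b ih =>
    rw [blockCrossing, map_mul, Subgroup.coe_mul, LinearEquiv.mul_apply, ih]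
    have hsum : ∑ m ∈ Finset.range b, t ^ m *
        (η (strandCrossing (s + b) a) : AutFree) x (s + m) =
        ∑ m ∈ Finset.range b, t ^ m * x (s + m) := by
      refine Finset.sum_congr rfl fun m hm => ?_
      have := Finset.mem_range.1 hm
      rw [η_strandCrossing_apply, if_pos (by omega)]
    rw [hsum, Finset.sum_range_succ]
    simp only [η_strandCrossing_apply]
    split_ifs <;> first
      | omega
      | rfl
      | (congr 1; omega)
      | (rw [show k + (b + 1) = k + b + 1 by omega]; ring)

lemma isFinitary_η_blockCrossing (s a b : ℕ) :
    IsFinitary (s + a + b) (η (blockCrossing s a b) : AutFree) := by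
  refine isFinitary_iff.2 ⟨fun j hj => ?_, fun i hi x => ?_⟩
  · ext1 k
    rw [η_blockCrossing_apply]
    split_ifs
    · rfl
    · rw [Finset.sum_eq_zero, Finsupp.single_eq_of_ne (by omega),
        Finsupp.single_eq_of_ne (by omega)]
      · ring
      · intro m hm
        have := Finset.mem_range.1 hm
        rw [Finsupp.single_eq_of_ne (by omega), mul_zero]
    · rw [Finsupp.single_eq_of_ne (by omega), Finsupp.single_eq_of_ne (by omega)]
    · rfl
  · rw [η_blockCrossing_apply, if_neg (by omega), if_neg (by omega), if_neg (by omega)]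

/-! ### The matrices `Theta` and their commutation with `fixSub` -/

lemma Theta_eq_shift (n s : ℕ) : Theta n s = shift s (Theta n 0) := by
  rw [Theta, Theta, shift_shift, add_zero]

lemma Theta_zero_apply (n : ℕ) (x : ℕ →₀ R) (k : ℕ) :
    (Theta n 0 : AutFree) x k =
      if k < n then (1 - t) * ∑ m ∈ Finset.range n, t ^ m * x m + t ^ n * x (n + k)
      else if k < n + n then x (k - n) else x k := by
  rw [Theta, shift_apply, if_neg (by omega), ofGL_apply, Nat.sub_zero]
  have h0 (i : ℕ) : (split 0 x).2 i = x i := by rw [split_snd, zero_add]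
  -- The first `2n` coordinates are regrouped into two blocks of size `n`, undoing the reindexing of
  -- `ThetaBlock n`.
  set y : Fin n ⊕ Fin n → R := fun i => x (finSumFinEquiv i : Fin (n + n)) with hy
  have key (i : Fin n ⊕ Fin n) :
      (Units.mapEquiv (Matrix.reindexRingEquiv R finSumFinEquiv).toMulEquiv (ThetaBlock n)).1.mulVec
        (split (n + n) (split 0 x).2).1 (finSumFinEquiv i) = (ThetaBlock n).1.mulVec y i := by
    have : (split (n + n) (split 0 x).2).1 = y ∘ finSumFinEquiv.symm := by
      ext1 j
      simp [split_fst, h0, hy]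
    rw [this]
    change (Matrix.reindex finSumFinEquiv finSumFinEquiv (ThetaBlock n).1).mulVec _ _ = _
    rw [Matrix.reindex_apply, Matrix.submatrix_mulVec_equiv]
    simp [Function.comp_def]
  split_ifs with h1 h2 h2
  · have := key (Sum.inl ⟨k, h2⟩)
    simp only [finSumFinEquiv_apply_left, Fin.castAdd_mk] at this
    rw [this, add_comm n k]
    simp [ThetaBlock, Matrix.mulVec, dotProduct, Matrix.one_apply, hy, Vmat, Finset.mul_sum,
      Finset.sum_range, mul_assoc]
  · have := key (Sum.inr ⟨k - n, by omega⟩)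
    simp only [finSumFinEquiv_apply_right, Fin.natAdd_mk, Nat.add_sub_cancel' (not_lt.1 h2)] at this
    rw [this]
    simp [ThetaBlock, Matrix.mulVec, dotProduct, Matrix.one_apply, hy]
  · omega
  · exact h0 k

lemma η_blockCrossing (n s : ℕ) : η (blockCrossing s n n) = Theta n s := by
  refine GLInf.ext_apply fun x k => ?_
  rw [Theta_eq_shift, shift_apply, η_blockCrossing_apply, Theta_zero_apply]
  simp only [split_snd]
  split_ifs <;> first
    | omega
    | rfl
    | (congr 1; omega)
    | (congr 3; omega)

/-- On the first `n` coordinates, `Theta n 0` returns a multiple of `u` plus `t ^ n` times the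
second block of `x`. As `Y` fixes `u`, it acts only on that second block, and this is the effect of
applying `shift n Y` beforehand. -/
lemma mul_Theta_zero {Y : GLInf} (hY : Y ∈ fixSub) {n : ℕ} (hn : IsFinitary n (Y : AutFree)) :
    Y * Theta n 0 = Theta n 0 * shift n Y := by
  refine GLInf.ext_apply fun x k => ?_
  rw [Subgroup.coe_mul, Subgroup.coe_mul, LinearEquiv.mul_apply, LinearEquiv.mul_apply]
  have h := (isFinitary_iff.1 hn).2
  set c := (1 - t) * ∑ m ∈ Finset.range n, t ^ m * x m
  set x' := (split n x).2 with hx'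
  set y := (Theta n 0 : AutFree) x with hy
  -- The vector `y - c • uTrunc n - t ^ n • x'` vanishes on the first `n` coordinates, hence is
  -- fixed by `Y`, as is `uTrunc n`.
  have e : (Y : AutFree) y = y + t ^ n • ((Y : AutFree) x' - x') := by
    have := hn.apply_of_vanish (w := y - c • uTrunc n - t ^ n • x') fun k hk => by
      simp only [Finsupp.sub_apply, Finsupp.smul_apply, smul_eq_mul, hy, Theta_zero_apply,
        uTrunc_apply, if_pos hk, hx', split_snd]
      ring
    rw [map_sub, map_sub, map_smul, map_smul, apply_uTrunc_of_mem hY hn] at this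
    rw [smul_sub]
    rw [sub_sub, sub_sub, sub_eq_iff_eq_add] at this
    rw [this]
    abel
  rw [e, Finsupp.add_apply, Finsupp.smul_apply, Finsupp.sub_apply, smul_eq_mul, hy,
    Theta_zero_apply, Theta_zero_apply]
  have hsum : ∑ m ∈ Finset.range n, t ^ m * (shift n Y : AutFree) x m =
      ∑ m ∈ Finset.range n, t ^ m * x m := by
    refine Finset.sum_congr rfl fun m hm => ?_
    rw [shift_apply, if_pos (Finset.mem_range.1 hm)]
  rw [hsum]
  simp only [shift_apply]
  split_ifs
  all_goals first | omega | skip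
  · rw [Nat.add_sub_cancel_left, ← hx', hx', split_snd]
    ring
  · rw [h k (by omega)]
    ring
  · rw [h k (by omega), h (k - n) (by omega), hx', split_snd, split_snd,
      Nat.add_sub_cancel' (by omega)]
    ring

/-- The first block of `x` enters the upper rows of `Theta n 0` only through the truncated form `v`,
which `Y` preserves. It is also copied to the second block, where `shift n Y` reproduces the action
of `Y`. -/
lemma Theta_zero_mul {Y : GLInf} (hY : Y ∈ fixSub) {n : ℕ} (hn : IsFinitary n (Y : AutFree)) :
    Theta n 0 * Y = shift n Y * Theta n 0 := by
  refine GLInf.ext_apply fun x k => ?_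
  rw [Subgroup.coe_mul, Subgroup.coe_mul, LinearEquiv.mul_apply, LinearEquiv.mul_apply]
  have h := (isFinitary_iff.1 hn).2
  have hsum : ∑ m ∈ Finset.range n, t ^ m * (Y : AutFree) x m =
      ∑ m ∈ Finset.range n, t ^ m * x m := by
    rw [← sub_eq_zero, ← Finset.sum_sub_distrib]
    have := vForm_eq_sum (N := n) (x := (Y : AutFree) x - x) fun k hk => by
      rw [Finsupp.sub_apply, h k hk, sub_self]
    rw [map_sub, vForm_apply_of_mem hY, sub_self] at this
    simp only [this, Finsupp.sub_apply, mul_sub]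
  set z := (split n ((Theta n 0 : AutFree) x)).2 with hz
  -- The first `n` coordinates of `z` are those of `x`, so `Y` fixes `z - x`.
  have e : (Y : AutFree) z = (Y : AutFree) x + (z - x) := by
    rw [← sub_eq_iff_eq_add', ← map_sub]
    refine hn.apply_of_vanish fun k hk => ?_
    rw [Finsupp.sub_apply, hz, split_snd, Theta_zero_apply, if_neg (by omega), if_pos (by omega),
      Nat.add_sub_cancel_left, sub_self]
  rw [Theta_zero_apply, shift_apply, ← hz, e, hsum, Finsupp.add_apply, Finsupp.sub_apply]
  split_ifs with h1 h2
  · rw [Theta_zero_apply, if_pos h1, h _ (by omega)]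
  · rw [hz, split_snd, Theta_zero_apply, if_neg (by omega), if_pos (by omega),
      Nat.add_sub_cancel_left, sub_self, add_zero]
  · rw [hz, split_snd, Theta_zero_apply, if_neg (by omega), if_neg (by omega), h k (by omega),
      h (k - n) (by omega), Nat.add_sub_cancel' (by omega)]
    ring

lemma isBlockCrossing_η_blockCrossing :
    IsBlockCrossing GSub fun s a b => η (blockCrossing s a b) where
  anti := GSub_antitone
  exists_centralizes g := g.2.imp fun _ hN => centralizes_GSub hN
  mem s a b := η_mem_GSub s _ (blockCrossing_mem s a b)
  centralizes s a b := centralizes_GSub (isFinitary_η_blockCrossing s a b)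
  add_right s a b d := by rw [blockCrossing_add_right, map_mul]
  add_left s a c d := by rw [blockCrossing_add_left, map_mul]
  push_right := by
    rintro s _ ⟨Y, hY, rfl⟩
    obtain ⟨N, hN⟩ := Y.2
    refine ⟨N, fun n hn => ⟨shift (s + n) Y, shift_mem_GSub le_rfl hY, ?_⟩⟩
    rw [η_blockCrossing, Theta_eq_shift, ← shift_shift, ← map_mul, ← map_mul,
      mul_Theta_zero hY (hN.mono hn)]
  push_left := by
    rintro s _ ⟨Y, hY, rfl⟩
    obtain ⟨N, hN⟩ := Y.2
    refine ⟨N, fun n hn => ⟨shift (s + n) Y, shift_mem_GSub le_rfl hY, ?_⟩⟩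
    rw [η_blockCrossing, Theta_eq_shift, ← shift_shift, ← map_mul, ← map_mul,
      Theta_zero_mul hY (hN.mono hn)]

end BurauFunctor

theorem proposition1p12 :
    ∃ (μB : BurauFunctor.DoubleCosetOperation BurauFunctor.BSub)
      (μG : BurauFunctor.DoubleCosetOperation BurauFunctor.GSub),
      μB.IsLimitProduct BurauFunctor.θ ∧ μG.IsLimitProduct BurauFunctor.Theta ∧
      ∃ (F : BurauFunctor.DCosCat μB ⥤ BurauFunctor.DCosCat μG)
        (hF : ∀ r : ℕ, F.obj (BurauFunctor.DCosCat.mk r) = BurauFunctor.DCosCat.mk r),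
        ∀ (r s : ℕ) (p : BurauFunctor.BInf),
          F.map (BurauFunctor.DCosCat.homMk μB r s p) =
            eqToHom (hF r) ≫ BurauFunctor.DCosCat.homMk μG r s (BurauFunctor.η p) ≫
              eqToHom (hF s).symm := by
  have hB := BurauFunctor.isBlockCrossing_blockCrossing.operation_isLimitProduct
    BurauFunctor.blockCrossing_eq_θ
  have hG := BurauFunctor.isBlockCrossing_η_blockCrossing.operation_isLimitProduct
    BurauFunctor.η_blockCrossing
  refine ⟨_, _, hB, hG, BurauFunctor.DCosCat.functor hB hG BurauFunctor.η BurauFunctor.η_mem_GSub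
    (fun n s => by rw [← BurauFunctor.blockCrossing_eq_θ, BurauFunctor.η_blockCrossing]),
    fun _ => rfl, fun r s p => ?_⟩
  -- The equalities of objects hold by `rfl`, so both `eqToHom` are identities.
  exact ((Category.id_comp _).trans (Category.comp_id _)).symm
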